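/- Let $A\in\mathbb C^{n\times n}$, let $N\ge 1$, and let $z_1,\dots,z_N\in\mathbb C$ be arbitrary, possibly repeated, points. Let $f$ be analytic on an open set containing the convex hull of $\sigma(A)\cup\{z_1,\dots,z_N\}$, where $\sigma(A)$ is the spectrum of $A$. Let $u,v$ be polynomials with $\deg u\le N-1$, with $v(z_k)\neq0$ for $k=1,\dots,N$ and $v(\lambda)\ne0$ for all $\lambda\in\sigma(A)$, and suppose that $r=u/v$ interpolates $f$ at $z_1,\dots,z_N$ counted with multiplicities: for every $k$, $$r^{(j)}(z_k)=f^{(j)}(z_k),\qquad j=0,1,\dots,n_k-1,$$ where $n_k$ is the number of indices $i$ with $z_i=z_k$. Put $\Omega(z)=\prod_{k=1}^N(z-z_k)$. For a function $g$ analytic in a neighbourhood of the spectrum of a matrix $B$, let $$g(B)=\frac1{2\pi i}\int_\Gamma g(\lambda)(\lambda\mathbf 1-B)^{-1}\,d\lambda,$$ where the contour $\Gamma$ encloses the spectrum of $B$ (for instance, $\Gamma$ is the positively oriented boundary of a finite union of disjoint closed discs whose interiors cover the spectrum of $B$ and on which $g$ is analytic). Then $v(A)$ is invertible, and for all $b,d\in\mathbb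 C^n$ the maximum below is attained and $$\bigl|d^H\bigl(f(A)-r(A)\bigr)b\bigr|\le\max_{\substack{t\in[0,1]\\ \mu\in\operatorname{co}\{z_1,\dots,z_N\}}}\left|d^H\left[\Omega(A)[v(A)]^{-1}\frac{(vf)^{(N)}\bigl((1-t)\mu\mathbf 1+tA\bigr)}{N!}\right]b\right|,$$ where $\operatorname{co}$ denotes the convex hull and $d^H$ the conjugate transpose of $d$. -/

import Mathlib

open scoped Matrix

/-- The finite family `Γ` of circles (pairs of a centre and a radius) is a contour, made of the
positively oriented boundaries of pairwise disjoint closed discs, that encloses the spectrum of `A`;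
the function `f` is analytic on (a neighbourhood of) the closed discs that the contour surrounds. -/
structure EnclosesSpectrum {n : ℕ} (Γ : Finset (ℂ × ℝ)) (f : ℂ → ℂ)
    (A : Matrix (Fin n) (Fin n) ℂ) : Prop where
  radius_pos : ∀ p ∈ Γ, 0 < p.2
  disjoint : ∀ p ∈ Γ, ∀ q ∈ Γ, p ≠ q →
    Disjoint (Metric.closedBall p.1 p.2) (Metric.closedBall q.1 q.2)
  analytic : ∀ p ∈ Γ, AnalyticOnNhd ℂ f (Metric.closedBall p.1 p.2)
  encloses : ∀ l ∈ spectrum ℂ A, ∃ p ∈ Γ, l ∈ Metric.ball p.1 p.2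

/-- The matrix `(2πi)⁻¹ ∫_Γ f(z) (z 1 - A)⁻¹ dz`, the integral being taken entrywise over the
circles of `Γ`. -/
noncomputable def resolventIntegral {n : ℕ} (Γ : Finset (ℂ × ℝ)) (f : ℂ → ℂ)
    (A : Matrix (Fin n) (Fin n) ℂ) : Matrix (Fin n) (Fin n) ℂ :=
  Matrix.of fun i j =>
    (2 * Real.pi * Complex.I : ℂ)⁻¹ *
      ∑ p ∈ Γ, ∮ z in C(p.1, p.2),
        f z * (z • (1 : Matrix (Fin n) (Fin n) ℂ) - A)⁻¹ i j

open Classical in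
/-- The function `f` applied to the matrix `A`: the Cauchy integral of `f` against the resolvent
of `A` over a contour that encloses the spectrum of `A`. Such a contour exists whenever `f` is
analytic in a neighbourhood of the spectrum (take small circles around the eigenvalues), and the
integral does not depend on it; the value is `0` if there is none. -/
noncomputable def matrixFunction {n : ℕ} (f : ℂ → ℂ) (A : Matrix (Fin n) (Fin n) ℂ) :
    Matrix (Fin n) (Fin n) ℂ :=
  if h : ∃ Γ : Finset (ℂ × ℝ), EnclosesSpectrum Γ f A then resolventIntegral h.choose f A else 0

/-- The multiplicity of `w` in the list of points `z`. -/
noncomputable def nodeMultiplicity {N : ℕ} (z : Fin N → ℂ) (w : ℂ) : ℕ :=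
  Nat.card {i : Fin N // z i = w}

/-- The function `r` interpolates `f` at the points `z 0, …, z (N - 1)`, counted with
multiplicities. -/
def Interpolates {N : ℕ} (r f : ℂ → ℂ) (z : Fin N → ℂ) : Prop :=
  ∀ k : Fin N, ∀ j < nodeMultiplicity z (z k), iteratedDeriv j r (z k) = iteratedDeriv j f (z k)

/-- The rational function `u / v`. -/
noncomputable def ratioFun (u v : Polynomial ℂ) : ℂ → ℂ := fun w => u.eval w / v.eval w

/-- The node polynomial `Ω(w) = ∏ₖ (w - zₖ)`. -/
noncomputable def nodePolynomial {N : ℕ} (z : Fin N → ℂ) : Polynomial ℂ :=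
  ∏ k : Fin N, (Polynomial.X - Polynomial.C (z k))

/-- The number `dᴴ X b`. -/
def sandwich {n : ℕ} (d : Fin n → ℂ) (X : Matrix (Fin n) (Fin n) ℂ) (b : Fin n → ℂ) : ℂ :=
  star d ⬝ᵥ (X *ᵥ b)

/-- The matrix `Ω(A) v(A)⁻¹ (v f)^(N)((1 - t) μ 1 + t A) / N!`. -/
noncomputable def remainderMatrix {n N : ℕ} (A : Matrix (Fin n) (Fin n) ℂ) (z : Fin N → ℂ)
    (f : ℂ → ℂ) (v : Polynomial ℂ) (t : ℝ) (μ : ℂ) : Matrix (Fin n) (Fin n) ℂ :=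
  Polynomial.aeval A (nodePolynomial z) * (Polynomial.aeval A v)⁻¹ *
    ((N.factorial : ℂ)⁻¹ •
      matrixFunction (iteratedDeriv N (fun w => v.eval w * f w))
        (((1 - (t : ℂ)) * μ) • (1 : Matrix (Fin n) (Fin n) ℂ) + (t : ℂ) • A))

/-!
Since `r` interpolates `f`, the function `v f - u` equals `Ω G` with `G` analytic, and therefore
`f(A) - r(A) = Ω(A) v(A)⁻¹ G(A)`; as `deg u < N`, the functions `v f` and `Ω G` have the same
`N`-th derivative. It remains to bound a scalar functional of `G(A)` by the same functional of
`(Ω G)^(N)((1 - t) μ 1 + t A) / N!`.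

Along a decomposition of `ℂⁿ` into generalized eigenspaces of `A`, such a functional is a fixed
linear combination of the jets of `G` at the eigenvalues, so it may be differentiated term by term.
For one node `c` the identity
`d/dx (x ^ (k + 1) g^(k)(c + x (w - c))) = x ^ k ((· - c) g)^(k + 1)(c + x (w - c))`
and an integration over `[0, 1]` bound the functional of `g^(k)` by `1 / (k + 1)` times the maximum
of that of `((· - c) g)^(k + 1)` on the segments issuing from `c`. Removing the nodes one after the
other produces the factor `1 / N!`, and a composition of homotheties `w ↦ (1 - t) μ + t w` with
centres in the convex set `co {z₁, …, z_N}` is again one.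
-/

section Derivatives

theorem iteratedDeriv_iteratedDeriv {𝕜 F : Type*} [NontriviallyNormedField 𝕜]
    [NormedAddCommGroup F] [NormedSpace 𝕜 F] (i j : ℕ) (f : 𝕜 → F) :
    iteratedDeriv i (iteratedDeriv j f) = iteratedDeriv (i + j) f := by
  simp only [iteratedDeriv_eq_iterate, Function.iterate_add_apply]

theorem iteratedDeriv_comp_const_add_mul {𝕜 F : Type*} [NontriviallyNormedField 𝕜]
    [NormedAddCommGroup F] [NormedSpace 𝕜 F] (j : ℕ) (f : 𝕜 → F) (κ τ : 𝕜) :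
    iteratedDeriv j (fun w => f (κ + τ * w)) = fun w => τ ^ j • iteratedDeriv j f (κ + τ * w) := by
  induction j with
  | zero => simp
  | succ j ih =>
    ext w
    rw [iteratedDeriv_succ, ih, deriv_fun_const_smul_field,
      deriv_comp_mul_left τ (fun y => iteratedDeriv j f (κ + y)), deriv_comp_const_add,
      iteratedDeriv_succ, smul_smul, pow_succ]

theorem analyticAt_iteratedDeriv {𝕜 F : Type*} [NontriviallyNormedField 𝕜]
    [NormedAddCommGroup F] [NormedSpace 𝕜 F] [CompleteSpace F] {f : 𝕜 → F} {x : 𝕜}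
    (hf : AnalyticAt 𝕜 f x) (j : ℕ) : AnalyticAt 𝕜 (iteratedDeriv j f) x := by
  rw [iteratedDeriv_eq_iterate]
  exact hf.iterated_deriv j

theorem hasDerivAt_iteratedDeriv {𝕜 F : Type*} [NontriviallyNormedField 𝕜]
    [NormedAddCommGroup F] [NormedSpace 𝕜 F] [CompleteSpace F] {f : 𝕜 → F} {x : 𝕜}
    (hf : AnalyticAt 𝕜 f x) (j : ℕ) :
    HasDerivAt (iteratedDeriv j f) (iteratedDeriv (j + 1) f x) x := by
  rw [iteratedDeriv_succ]
  exact (analyticAt_iteratedDeriv hf j).differentiableAt.hasDerivAt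

theorem iteratedDeriv_sub_const_mul {𝕜 : Type*} [NontriviallyNormedField 𝕜] [CompleteSpace 𝕜]
    {g : 𝕜 → 𝕜} {x : 𝕜} (hg : AnalyticAt 𝕜 g x) (c : 𝕜) (j : ℕ) :
    iteratedDeriv j (fun y => (y - c) * g y) x =
      (x - c) * iteratedDeriv j g x + j * iteratedDeriv (j - 1) g x := by
  induction j generalizing x with
  | zero => simp
  | succ j ih =>
    have hderiv := (((hasDerivAt_id x).sub_const c).mul (hasDerivAt_iteratedDeriv hg j)).add
      ((hasDerivAt_iteratedDeriv hg (j - 1)).const_mul (j : 𝕜))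
    rw [iteratedDeriv_succ,
      Filter.EventuallyEq.deriv_eq (hg.eventually_analyticAt.mono fun y hy => ih hy)]
    refine hderiv.deriv.trans ?_
    cases j with
    | zero => simp [add_comm]
    | succ j =>
      simp only [id, Nat.add_sub_cancel]
      push_cast
      ring

theorem iteratedDeriv_polynomial_eval {𝕜 : Type*} [NontriviallyNormedField 𝕜]
    (p : Polynomial 𝕜) (j : ℕ) :
    iteratedDeriv j (fun y => p.eval y) = fun y => (Polynomial.derivative^[j] p).eval y := by
  induction j generalizing p with
  | zero => rfl
  | succ j ih =>
    rw [iteratedDeriv_succ', Function.iterate_succ_apply, ← ih]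
    exact congrArg _ (funext fun _ => p.deriv)

theorem iteratedDeriv_sub_polynomial_eval {𝕜 : Type*} [NontriviallyNormedField 𝕜]
    {h : 𝕜 → 𝕜} {x : 𝕜} {j : ℕ} (hh : ContDiffAt 𝕜 j h x) {p : Polynomial 𝕜}
    (hp : p.natDegree < j) :
    iteratedDeriv j (fun y => h y - p.eval y) x = iteratedDeriv j h x := by
  have hpx : ContDiffAt 𝕜 j (fun y => p.eval y) x := by
    simpa using (p.contDiff_aeval (𝕜 := 𝕜) (n := j)).contDiffAt
  rw [iteratedDeriv_fun_sub hh hpx, iteratedDeriv_polynomial_eval,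
    Polynomial.iterate_derivative_eq_zero hp]
  simp only [Polynomial.eval_zero, sub_zero]

theorem hasDerivAt_pow_mul_iteratedDeriv_segment {g : ℂ → ℂ} {c w x : ℂ}
    (hg : AnalyticAt ℂ g ((1 - x) * c + x * w)) (k : ℕ) :
    HasDerivAt (fun x => x ^ (k + 1) * iteratedDeriv k g ((1 - x) * c + x * w))
      (x ^ k * iteratedDeriv (k + 1) (fun y => (y - c) * g y) ((1 - x) * c + x * w)) x := by
  have hline : HasDerivAt (fun x : ℂ => (1 - x) * c + x * w) (-1 * c + 1 * w) x :=
    (((hasDerivAt_id x).const_sub 1).mul_const c).add ((hasDerivAt_id x).mul_const w)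
  refine ((hasDerivAt_pow (k + 1) x).mul
    (HasDerivAt.comp x (hasDerivAt_iteratedDeriv hg k) hline)).congr_deriv ?_
  rw [iteratedDeriv_sub_const_mul hg]
  simp only [Function.comp, Nat.add_sub_cancel]
  push_cast
  ring

theorem analyticOnNhd_eval_mul {𝕜 : Type*} [NontriviallyNormedField 𝕜] {s : Set 𝕜} {f : 𝕜 → 𝕜}
    (hf : AnalyticOnNhd 𝕜 f s) (p : Polynomial 𝕜) :
    AnalyticOnNhd 𝕜 (fun y => p.eval y * f y) s := fun x hx =>
  (AnalyticOnNhd.eval_polynomial p x trivial).mul (hf x hx)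

end Derivatives

section CircleIntegral

open Metric

variable {E : Type*} [NormedAddCommGroup E] [NormedSpace ℂ E] {f : ℂ → E}
  {c w : ℂ} {R : ℝ}

theorem circleIntegrable_inv_sub_pow_smul (hR : 0 ≤ R) (hf : ContinuousOn f (sphere c R))
    (hw : w ∉ sphere c R) (j : ℕ) :
    CircleIntegrable (fun z => ((z - w) ^ j)⁻¹ • f z) c R :=
  (((by fun_prop : ContinuousOn (fun z => (z - w) ^ j) (sphere c R)).inv₀ fun _ hz =>
    pow_ne_zero j (sub_ne_zero.mpr (ne_of_mem_of_not_mem hz hw))).smul hf).circleIntegrable hR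

theorem circleIntegral_inv_sub_pow_succ_smul [CompleteSpace E] (hR : 0 ≤ R)
    (hf : AnalyticOnNhd ℂ f (closedBall c R)) (hw : w ∉ sphere c R) (j : ℕ) :
    (j + 1 : ℂ) • (∮ z in C(c, R), ((z - w) ^ (j + 2))⁻¹ • f z) =
      ∮ z in C(c, R), ((z - w) ^ (j + 1))⁻¹ • deriv f z := by
  have hderiv : ∀ z ∈ sphere c R, HasDerivAt (fun z => ((z - w) ^ (j + 1))⁻¹ • f z)
      (((z - w) ^ (j + 1))⁻¹ • deriv f z - ((z - w) ^ (j + 2))⁻¹ • ((j + 1 : ℂ) • f z)) z := by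
    intro z hz
    have hzw : z - w ≠ 0 := sub_ne_zero.mpr (ne_of_mem_of_not_mem hz hw)
    have hfz := (hf z (sphere_subset_closedBall hz)).differentiableAt.hasDerivAt
    refine (((((hasDerivAt_id z).sub_const w).pow (j + 1)).inv
      (pow_ne_zero _ hzw)).smul hfz).congr_deriv ?_
    simp only [id, Pi.pow_apply, Pi.inv_apply, Nat.add_sub_cancel]
    match_scalars <;> field_simp; ring
  have hf' := hf.mono sphere_subset_closedBall
  have hintegral := circleIntegral.integral_eq_zero_of_hasDerivWithinAt hR
    fun z hz => (hderiv z hz).hasDerivWithinAt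
  rw [circleIntegral.integral_sub
    (circleIntegrable_inv_sub_pow_smul hR hf'.deriv.continuousOn hw _)
    (circleIntegrable_inv_sub_pow_smul hR (hf'.continuousOn.fun_const_smul (j + 1 : ℂ)) hw _),
    sub_eq_zero] at hintegral
  rw [hintegral, ← circleIntegral.integral_smul]
  simp only [smul_comm (j + 1 : ℂ)]

theorem circleIntegral_inv_sub_pow_smul_of_mem_ball [CompleteSpace E]
    (hf : AnalyticOnNhd ℂ f (closedBall c R)) (hw : w ∈ ball c R) (j : ℕ) :
    (∮ z in C(c, R), ((z - w) ^ (j + 1))⁻¹ • f z) =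
      (2 * Real.pi * Complex.I / j.factorial : ℂ) • iteratedDeriv j f w := by
  induction j generalizing f with
  | zero => simpa using hf.differentiableOn.circleIntegral_sub_inv_smul hw
  | succ j ih =>
    have hj : (j + 1 : ℂ) ≠ 0 := Nat.cast_add_one_ne_zero j
    have hsphere : w ∉ sphere c R := fun h => (mem_ball.mp hw).ne (mem_sphere.mp h)
    rw [← (IsUnit.mk0 _ hj).smul_left_cancel, circleIntegral_inv_sub_pow_succ_smul
      (pos_of_mem_ball hw).le hf hsphere, ih hf.deriv, ← iteratedDeriv_succ', smul_smul,
      Nat.factorial_succ]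
    congr 1
    push_cast
    field_simp

theorem circleIntegral_inv_sub_pow_smul_of_notMem_closedBall (hR : 0 < R)
    (hf : AnalyticOnNhd ℂ f (closedBall c R)) (hw : w ∉ closedBall c R) (j : ℕ) :
    (∮ z in C(c, R), ((z - w) ^ j)⁻¹ • f z) = 0 := by
  refine DiffContOnCl.circleIntegral_eq_zero hR.le (DifferentiableOn.diffContOnCl ?_)
  rw [closure_ball c hR.ne']
  exact (DifferentiableOn.inv (by fun_prop) fun z hz =>
    pow_ne_zero j (sub_ne_zero.mpr (ne_of_mem_of_not_mem hz hw))).smul hf.differentiableOn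

end CircleIntegral

theorem one_sub_mul_add_mul_mem {H : Set ℂ} (hH : Convex ℝ H) {μ w : ℂ} (hμ : μ ∈ H) (hw : w ∈ H)
    {t : ℝ} (ht : t ∈ Set.Icc (0 : ℝ) 1) : (1 - t) * μ + t * w ∈ H := by
  simpa using hH hμ hw (sub_nonneg.mpr ht.2) ht.1 (sub_add_cancel 1 t)

section JetSum

/-- A linear combination of the jets of order `m` of `g` at the points `lam i`, with coefficients
`C i j` in a vector space. Matrix functions of a fixed matrix are of this form. -/
noncomputable def jetSum {ι E : Type*} [Fintype ι] [AddCommGroup E] [Module ℂ E] (lam : ι → ℂ)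
    (m : ℕ) (C : ι → ℕ → E) (g : ℂ → ℂ) : E :=
  ∑ i, ∑ j ∈ Finset.range m, iteratedDeriv j g (lam i) • C i j

variable {ι E : Type*} [Fintype ι] {lam : ι → ℂ} {m : ℕ}

section Module

variable [AddCommGroup E] [Module ℂ E] {C : ι → ℕ → E} {g₁ g₂ : ℂ → ℂ}

theorem map_jetSum {F : Type*} [AddCommGroup F] [Module ℂ F] (l : E →ₗ[ℂ] F) (g : ℂ → ℂ) :
    l (jetSum lam m C g) = jetSum lam m (fun i j => l (C i j)) g := by
  simp only [jetSum, map_sum, map_smul]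

theorem jetSum_congr (h : ∀ i, g₁ =ᶠ[nhds (lam i)] g₂) :
    jetSum lam m C g₁ = jetSum lam m C g₂ := by
  simp only [jetSum, fun i j => (h i).iteratedDeriv_eq j]

theorem jetSum_add (h₁ : ∀ i, AnalyticAt ℂ g₁ (lam i)) (h₂ : ∀ i, AnalyticAt ℂ g₂ (lam i)) :
    jetSum lam m C (fun z => g₁ z + g₂ z) = jetSum lam m C g₁ + jetSum lam m C g₂ := by
  simp only [jetSum, ← Finset.sum_add_distrib, ← add_smul,
    fun i j => iteratedDeriv_fun_add (n := j) (h₁ i).contDiffAt (h₂ i).contDiffAt]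

theorem jetSum_sub (h₁ : ∀ i, AnalyticAt ℂ g₁ (lam i)) (h₂ : ∀ i, AnalyticAt ℂ g₂ (lam i)) :
    jetSum lam m C (fun z => g₁ z - g₂ z) = jetSum lam m C g₁ - jetSum lam m C g₂ := by
  simp only [jetSum, ← Finset.sum_sub_distrib, ← sub_smul,
    fun i j => iteratedDeriv_fun_sub (n := j) (h₁ i).contDiffAt (h₂ i).contDiffAt]

theorem jetSum_const_mul (a : ℂ) (g : ℂ → ℂ) :
    jetSum lam m C (fun z => a * g z) = a • jetSum lam m C g := by
  simp only [jetSum, Finset.smul_sum, iteratedDeriv_const_mul_field, mul_smul]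

theorem jetSum_comp_affine (g : ℂ → ℂ) (κ τ : ℂ) :
    jetSum lam m C (fun w => g (κ + τ * w)) =
      jetSum (fun i => κ + τ * lam i) m (fun i j => τ ^ j • C i j) g := by
  simp only [jetSum, iteratedDeriv_comp_const_add_mul, smul_smul, smul_eq_mul, mul_comm]

theorem jetSum_iteratedDeriv_sub_polynomial_eval {N : ℕ} {h : ℂ → ℂ} {κ τ : ℂ}
    (hh : ∀ i, AnalyticAt ℂ h (κ + τ * lam i)) {p : Polynomial ℂ} (hp : p.natDegree < N) :
    jetSum lam m C (fun w => iteratedDeriv N (fun y => h y - p.eval y) (κ + τ * w)) =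
      jetSum lam m C (fun w => iteratedDeriv N h (κ + τ * w)) := by
  rw [jetSum_comp_affine (iteratedDeriv N _), jetSum_comp_affine (iteratedDeriv N h)]
  exact jetSum_congr fun i => (hh i).eventually_analyticAt.mono fun w hw =>
    iteratedDeriv_sub_polynomial_eval hw.contDiffAt hp

end Module

variable [NormedAddCommGroup E] [NormedSpace ℂ E] {C : ι → ℕ → E} {H K : Set ℂ} {g : ℂ → ℂ}

theorem continuousOn_jetSum_segment (hg : AnalyticOnNhd ℂ g H)
    (hH : ∀ t ∈ Set.Icc (0 : ℝ) 1, ∀ μ ∈ K, ∀ i, (1 - t) * μ + t * lam i ∈ H) :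
    ContinuousOn
      (fun p : ℝ × ℂ => jetSum lam m C (fun w => g ((1 - p.1) * p.2 + p.1 * w)))
      (Set.Icc (0 : ℝ) 1 ×ˢ K) := by
  simp only [jetSum_comp_affine g]
  refine continuousOn_finsetSum _ fun i _ => continuousOn_finsetSum _ fun j _ => ?_
  have hjet : ContinuousOn (iteratedDeriv j g) H := fun x hx =>
    (analyticAt_iteratedDeriv (hg x hx) j).continuousAt.continuousWithinAt
  exact (hjet.comp (f := fun p : ℝ × ℂ => (1 - (p.1 : ℂ)) * p.2 + p.1 * lam i) (by fun_prop)
    fun p hp => hH p.1 hp.1 p.2 hp.2 i).smul (by fun_prop)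

theorem hasDerivAt_jetSum_segment {c x : ℂ}
    (hg : ∀ i, AnalyticAt ℂ g ((1 - x) * c + x * lam i)) (k : ℕ) :
    HasDerivAt
      (fun x => x ^ (k + 1) •
        jetSum lam m C (fun w => iteratedDeriv k g ((1 - x) * c + x * w)))
      (x ^ k • jetSum lam m C fun w =>
        iteratedDeriv (k + 1) (fun y => (y - c) * g y) ((1 - x) * c + x * w)) x := by
  have hjet (h : ℂ → ℂ) (k n : ℕ) (x : ℂ) : x ^ k •
      jetSum lam m C (fun w => iteratedDeriv n h ((1 - x) * c + x * w)) =
        ∑ i, ∑ j ∈ Finset.range m, (x ^ (j + k) *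
          iteratedDeriv (j + n) h ((1 - x) * c + x * lam i)) • C i j := by
    rw [jetSum_comp_affine (iteratedDeriv n h)]
    simp only [jetSum, Finset.smul_sum, iteratedDeriv_iteratedDeriv, smul_smul]
    refine Finset.sum_congr rfl fun i _ => Finset.sum_congr rfl fun j _ => ?_
    ring_nf
  simp only [hjet]
  exact HasDerivAt.fun_sum fun i _ => HasDerivAt.fun_sum fun j _ =>
    (hasDerivAt_pow_mul_iteratedDeriv_segment (hg i) (j + k)).smul_const (C i j)

theorem norm_jetSum_iteratedDeriv_le (hH : Convex ℝ H) (hg : AnalyticOnNhd ℂ g H) {c : ℂ}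
    (hc : c ∈ H) (hlam : ∀ i, lam i ∈ H) (k : ℕ) {M : ℝ}
    (hM : ∀ x ∈ Set.Icc (0 : ℝ) 1, ‖jetSum lam m C fun w =>
      iteratedDeriv (k + 1) (fun y => (y - c) * g y) ((1 - x) * c + x * w)‖ ≤ M) :
    ‖jetSum lam m C (iteratedDeriv k g)‖ ≤ M / (k + 1) := by
  have hderiv (x : ℝ) (hx : x ∈ Set.Icc (0 : ℝ) 1) :=
    (hasDerivAt_jetSum_segment (lam := lam) (m := m) (C := C) (x := x) (fun i =>
      hg _ (one_sub_mul_add_mul_mem hH hc (hlam i) hx)) k).scomp x Complex.ofRealCLM.hasDerivAt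
  have hbound (x : ℝ) : HasDerivAt (fun x : ℝ => M / (k + 1) * x ^ (k + 1)) (M * x ^ k) x := by
    refine ((hasDerivAt_pow (k + 1) x).const_mul (M / (k + 1))).congr_deriv ?_
    push_cast
    field_simp
  simpa using image_norm_le_of_norm_deriv_right_le_deriv_boundary' (a := 0) (b := 1)
    (fun x hx => (hderiv x hx).continuousAt.continuousWithinAt)
    (fun x hx => (hderiv x (Set.Ico_subset_Icc_self hx)).hasDerivWithinAt)
    (by simp)
    (fun x _ => (hbound x).continuousAt.continuousWithinAt)
    (fun x _ => (hbound x).hasDerivWithinAt)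
    (fun x hx => by
      simpa [norm_smul, abs_of_nonneg hx.1, mul_comm M] using
        mul_le_mul_of_nonneg_left (hM x (Set.Ico_subset_Icc_self hx)) (pow_nonneg hx.1 k))
    (Set.right_mem_Icc.mpr zero_le_one)

end JetSum

section NodePolynomial

variable {N : ℕ}

theorem nodePolynomial_succ (z : Fin (N + 1) → ℂ) :
    nodePolynomial z = (Polynomial.X - Polynomial.C (z 0)) * nodePolynomial (Fin.tail z) :=
  Fin.prod_univ_succ _

theorem nodeMultiplicity_eq_sum (z : Fin N → ℂ) (w : ℂ) :
    nodeMultiplicity z w = ∑ k, if z k = w then 1 else 0 := by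
  classical
  rw [nodeMultiplicity, Nat.card_eq_fintype_card, Fintype.card_subtype, Finset.card_filter]

theorem nodeMultiplicity_succ (z : Fin (N + 1) → ℂ) (w : ℂ) :
    nodeMultiplicity z w = (if z 0 = w then 1 else 0) + nodeMultiplicity (Fin.tail z) w := by
  rw [nodeMultiplicity_eq_sum, nodeMultiplicity_eq_sum, Fin.sum_univ_succ]
  rfl

theorem analyticOrderAt_sub_const_mul {𝕜 : Type*} [NontriviallyNormedField 𝕜] {g : 𝕜 → 𝕜}
    {w : 𝕜} (hg : AnalyticAt 𝕜 g w) (c : 𝕜) [Decidable (c = w)] :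
    analyticOrderAt (fun y => (y - c) * g y) w =
      (if c = w then 1 else 0 : ℕ) + analyticOrderAt g w := by
  rw [← Pi.mul_def, analyticOrderAt_mul (by fun_prop) hg]
  split_ifs with h
  · simp [h, analyticOrderAt_id_sub_const_self]
  · simp [analyticOrderAt_id_sub_const_of_ne (Ne.symm h)]

theorem exists_analyticOnNhd_eq_sub_const_mul {U : Set ℂ} (hU : IsOpen U) {φ : ℂ → ℂ}
    (hφ : AnalyticOnNhd ℂ φ U) {c : ℂ} (hc : c ∈ U) (hφc : φ c = 0) :
    ∃ g, AnalyticOnNhd ℂ g U ∧ φ = fun w => (w - c) * g w := by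
  refine ⟨dslope φ c, ((Complex.differentiableOn_dslope (hU.mem_nhds hc)).mpr
    hφ.differentiableOn).analyticOnNhd hU, funext fun w => ?_⟩
  rw [← smul_eq_mul, sub_smul_dslope, hφc, sub_zero]

theorem exists_analyticOnNhd_eq_nodePolynomial_mul {U : Set ℂ} (hU : IsOpen U)
    {z : Fin N → ℂ} (hz : ∀ k, z k ∈ U) {φ : ℂ → ℂ} (hφ : AnalyticOnNhd ℂ φ U)
    (hord : ∀ k, nodeMultiplicity z (z k) ≤ analyticOrderAt φ (z k)) :
    ∃ G, AnalyticOnNhd ℂ G U ∧ φ = fun w => (nodePolynomial z).eval w * G w := by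
  induction N generalizing φ with
  | zero => exact ⟨φ, hφ, by simp [nodePolynomial]⟩
  | succ N ih =>
    have hφc : φ (z 0) = 0 := by
      refine apply_eq_zero_of_analyticOrderAt_ne_zero fun h => ?_
      simpa [nodeMultiplicity_succ, h] using hord 0
    obtain ⟨g, hg, rfl⟩ := exists_analyticOnNhd_eq_sub_const_mul hU hφ (hz 0) hφc
    obtain ⟨G, hG, rfl⟩ := ih (z := Fin.tail z) (fun k => hz k.succ) hg fun k => by
      have h := hord k.succ
      rw [nodeMultiplicity_succ, analyticOrderAt_sub_const_mul (hg _ (hz k.succ)), Nat.cast_add,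
        ENat.add_le_add_iff_left (ENat.natCast_ne_top _)] at h
      exact h
    exact ⟨G, hG, by simp [nodePolynomial_succ, mul_assoc]⟩

theorem Interpolates.nodeMultiplicity_le_analyticOrderAt {z : Fin N → ℂ} {f : ℂ → ℂ}
    {u v : Polynomial ℂ} (hr : Interpolates (ratioFun u v) f z) (k : Fin N)
    (hf : AnalyticAt ℂ f (z k)) (hv : v.eval (z k) ≠ 0) :
    nodeMultiplicity z (z k) ≤ analyticOrderAt (fun w => v.eval w * f w - u.eval w) (z k) := by
  have hva : AnalyticAt ℂ (fun w => v.eval w) (z k) := v.differentiable.analyticAt _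
  have hra : AnalyticAt ℂ (ratioFun u v) (z k) := (u.differentiable.analyticAt _).div hva hv
  have herror : (fun w => v.eval w * f w - u.eval w) =ᶠ[nhds (z k)]
      (fun w => v.eval w) * (fun w => f w - ratioFun u v w) := by
    filter_upwards [hva.continuousAt.eventually_ne hv] with w hw
    simp only [Pi.mul_apply, ratioFun]
    field_simp
  rw [analyticOrderAt_congr herror, analyticOrderAt_mul hva (hf.fun_sub hra)]
  refine le_add_left ((natCast_le_analyticOrderAt_iff_iteratedDeriv_eq_zero
    (hf.fun_sub hra)).mpr fun j hj => ?_)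
  rw [iteratedDeriv_fun_sub hf.contDiffAt hra.contDiffAt, hr k j hj, sub_self]

theorem exists_mem_forall_convexCombination_eq {E : Type*} [AddCommGroup E] [Module ℝ E]
    {K : Set E} (hK : Convex ℝ K) {c μ : E} (hc : c ∈ K) (hμ : μ ∈ K) {x t : ℝ}
    (hx : x ∈ Set.Icc (0 : ℝ) 1) (ht : t ∈ Set.Icc (0 : ℝ) 1) :
    ∃ ν ∈ K, ∀ w, (1 - x) • c + x • ((1 - t) • μ + t • w) = (1 - x * t) • ν + (x * t) • w := by
  obtain ⟨ν, hν, h⟩ := hK.exists_mem_add_smul_eq hc hμ (sub_nonneg.mpr hx.2)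
    (mul_nonneg hx.1 (sub_nonneg.mpr ht.2))
  refine ⟨ν, hν, fun w => ?_⟩
  rw [show 1 - x * t = 1 - x + x * (1 - t) by ring, h]
  module

theorem norm_jetSum_le_of_nodePolynomial_mul {ι E : Type*} [Fintype ι] [NormedAddCommGroup E]
    [NormedSpace ℂ E] {lam : ι → ℂ} {m : ℕ} {C : ι → ℕ → E} {H K : Set ℂ} (hH : Convex ℝ H)
    (hlam : ∀ i, lam i ∈ H) (hK : Convex ℝ K) (hKne : K.Nonempty) (hKH : K ⊆ H)
    {z : Fin N → ℂ} (hz : ∀ k, z k ∈ K) {G : ℂ → ℂ} (hG : AnalyticOnNhd ℂ G H) {M : ℝ}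
    (hM : ∀ t ∈ Set.Icc (0 : ℝ) 1, ∀ μ ∈ K, ‖jetSum lam m C fun w =>
      iteratedDeriv N (fun y => (nodePolynomial z).eval y * G y) ((1 - t) * μ + t * w)‖ ≤ M) :
    ‖jetSum lam m C G‖ ≤ M / N.factorial := by
  induction N generalizing M with
  | zero =>
    obtain ⟨μ, hμ⟩ := hKne
    simpa [nodePolynomial] using hM 1 (Set.right_mem_Icc.mpr zero_le_one) μ hμ
  | succ N ih =>
    have hquotient : AnalyticOnNhd ℂ (fun y => (nodePolynomial (Fin.tail z)).eval y * G y) H :=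
      analyticOnNhd_eval_mul hG _
    refine (ih (z := Fin.tail z) (fun k => hz k.succ) (M := M / (N + 1))
      fun t ht μ hμ => ?_).trans_eq ?_
    · rw [jetSum_comp_affine (iteratedDeriv N _)]
      refine norm_jetSum_iteratedDeriv_le hH hquotient (hKH (hz 0)) (fun i =>
        one_sub_mul_add_mul_mem hH (hKH hμ) (hlam i) ht) N fun x hx => ?_
      obtain ⟨ν, hν, hcomb⟩ := exists_mem_forall_convexCombination_eq hK (hz 0) hμ hx ht
      rw [← jetSum_comp_affine fun w => iteratedDeriv (N + 1) _ ((1 - x) * z 0 + x * w)]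
      have h := hM (x * t) ⟨mul_nonneg hx.1 ht.1, mul_le_one₀ hx.2 ht.1 ht.2⟩ ν hν
      simp only [Complex.real_smul] at hcomb
      push_cast at h hcomb
      simp only [hcomb]
      simpa [nodePolynomial_succ, mul_assoc] using h
    · rw [Nat.factorial_succ, Nat.cast_mul, Nat.cast_add_one, div_div]

end NodePolynomial

/-- A decomposition of the identity of an algebra into elements `P i`, each annihilated by
`(a - lam i) ^ m` for a spectral value `lam i` of `a`: the projections onto the generalized
eigenspaces are the model, but the `P i` need not be idempotent nor the `lam i` distinct, which
makes the notion stable under `a ↦ κ + τ a` for every `τ`, including `τ = 0`. -/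
structure IsSpectralResolution {ι K R : Type*} [Fintype ι] [Field K] [Ring R] [Algebra K R]
    (a : R) (m : ℕ) (lam : ι → K) (P : ι → R) : Prop where
  mem_spectrum : ∀ i, lam i ∈ spectrum K a
  sum_eq_one : ∑ i, P i = 1
  pow_mul_eq_zero : ∀ i, (a - algebraMap K R (lam i)) ^ m * P i = 0

section SpectralResolution

variable {ι K R : Type*} [Field K] [Ring R] [Algebra K R] {a : R} {m : ℕ} {lam : ι → K}
  {P : ι → R}

theorem exists_isSpectralResolution_of_aeval_eq_zero [DecidableEq K] {p : Polynomial K}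
    (hmonic : p.Monic) (hsplits : p.Splits) (hp : Polynomial.aeval a p = 0)
    (hroots : ∀ l ∈ p.roots, l ∈ spectrum K a) :
    ∃ P, IsSpectralResolution a p.natDegree (fun l : p.roots.toFinset => (l : K)) P := by
  set q : p.roots.toFinset → Polynomial K := fun l =>
    (Polynomial.X - Polynomial.C (l : K)) ^ p.natDegree with hq
  have hdvd : p ∣ ∏ l, q l := by
    nth_rw 1 [hsplits.eq_prod_roots_of_monic hmonic, Finset.prod_multiset_map_count]
    rw [← Finset.prod_coe_sort]
    exact Finset.prod_dvd_prod_of_dvd _ _ fun l _ => pow_dvd_pow _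
      ((Multiset.count_le_card _ _).trans (Polynomial.card_roots' p))
  have hprod : Polynomial.aeval a (∏ l, q l) = 0 :=
    Polynomial.aeval_eq_zero_of_dvd_aeval_eq_zero hdvd hp
  cases isEmpty_or_nonempty p.roots.toFinset with
  | inl _ =>
    exact ⟨0, fun l => isEmptyElim l, by simpa using hprod.symm, fun l => isEmptyElim l⟩
  | inr _ =>
    obtain ⟨c, hc⟩ := (exists_sum_eq_one_iff_pairwise_coprime' (s := q)).mpr fun l l' hne =>
      (Polynomial.isCoprime_X_sub_C_of_isUnit_sub
        (sub_ne_zero.mpr fun h => hne (Subtype.ext h)).isUnit).pow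
    refine ⟨fun l => Polynomial.aeval a (c l * ∏ l' ∈ {l}ᶜ, q l'), fun l => ?_, ?_, fun l => ?_⟩
    · exact hroots l (Multiset.mem_toFinset.mp l.2)
    · rw [← map_sum, hc, map_one]
    · have hfactor : (a - algebraMap K R l) ^ p.natDegree = Polynomial.aeval a (q l) := by
        simp [hq]
      rw [hfactor, ← map_mul, mul_left_comm, ← Fintype.prod_eq_mul_prod_compl, map_mul, hprod,
        mul_zero]

theorem exists_isSpectralResolution_matrix {n : Type*} [Fintype n] [DecidableEq n]
    [IsAlgClosed K] [DecidableEq K] (A : Matrix n n K) :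
    ∃ P, IsSpectralResolution A A.charpoly.natDegree
      (fun l : A.charpoly.roots.toFinset => (l : K)) P :=
  exists_isSpectralResolution_of_aeval_eq_zero A.charpoly_monic (IsAlgClosed.splits _)
    A.aeval_self_charpoly fun _ hl =>
      Matrix.mem_spectrum_iff_isRoot_charpoly.mpr (Polynomial.isRoot_of_mem_roots hl)

theorem algebraMap_sub_mul_sum_geom {l : K} {p : R}
    (hp : (a - algebraMap K R l) ^ m * p = 0) {z : K} (hz : z ≠ l) :
    (algebraMap K R z - a) *
      ∑ j ∈ Finset.range m, ((z - l) ^ (j + 1))⁻¹ • ((a - algebraMap K R l) ^ j * p) = p := by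
  have hzl : z - l ≠ 0 := sub_ne_zero.mpr hz
  set b := a - algebraMap K R l with hb
  have hresolvent : algebraMap K R z - a = (z - l) • (1 - (z - l)⁻¹ • b) := by
    rw [smul_sub, smul_inv_smul₀ hzl, ← Algebra.algebraMap_eq_smul_one, map_sub, hb]
    abel
  have hgeom : ∑ j ∈ Finset.range m, ((z - l) ^ (j + 1))⁻¹ • (b ^ j * p) =
      (z - l)⁻¹ • ((∑ j ∈ Finset.range m, ((z - l)⁻¹ • b) ^ j) * p) := by
    simp only [Finset.sum_mul, Finset.smul_sum, smul_pow, smul_mul_assoc, smul_smul, pow_succ',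
      mul_inv, inv_pow]
  rw [hresolvent, hgeom, smul_mul_smul_comm, mul_inv_cancel₀ hzl, one_smul, ← mul_assoc,
    mul_neg_geom_sum, sub_mul, one_mul, smul_pow, smul_mul_assoc, hp, smul_zero, sub_zero]

theorem algebraMap_add_smul_sub (a : R) (κ τ l : K) :
    algebraMap K R κ + τ • a - algebraMap K R (κ + τ * l) = τ • (a - algebraMap K R l) := by
  rw [map_add, map_mul, smul_sub, Algebra.smul_def, Algebra.smul_def]
  abel

namespace IsSpectralResolution

variable [Fintype ι]

theorem affine (h : IsSpectralResolution a m lam P) (κ τ : K) :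
    IsSpectralResolution (algebraMap K R κ + τ • a) m (fun i => κ + τ * lam i) P where
  mem_spectrum i := by
    have := spectrum.subset_polynomial_aeval a (Polynomial.C κ + Polynomial.C τ * Polynomial.X)
      ⟨lam i, h.mem_spectrum i, rfl⟩
    simpa [Algebra.smul_def] using this
  sum_eq_one := h.sum_eq_one
  pow_mul_eq_zero i := by
    rw [algebraMap_add_smul_sub, smul_pow, smul_mul_assoc, h.pow_mul_eq_zero, smul_zero]

theorem algebraMap_sub_mul_sum (h : IsSpectralResolution a m lam P) {z : K}
    (hz : ∀ i, z ≠ lam i) :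
    (algebraMap K R z - a) * ∑ i, ∑ j ∈ Finset.range m,
      ((z - lam i) ^ (j + 1))⁻¹ • ((a - algebraMap K R (lam i)) ^ j * P i) = 1 := by
  rw [Finset.mul_sum, ← h.sum_eq_one]
  exact Finset.sum_congr rfl fun i _ =>
    algebraMap_sub_mul_sum_geom (h.pow_mul_eq_zero i) (hz i)

theorem mem_range_of_mem_spectrum [IsDedekindFiniteMonoid R]
    (h : IsSpectralResolution a m lam P) {l : K} (hl : l ∈ spectrum K a) : l ∈ Set.range lam := by
  by_contra hne
  exact hl (IsUnit.of_mul_eq_one _ (h.algebraMap_sub_mul_sum fun i hi => hne ⟨i, hi.symm⟩))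

end IsSpectralResolution

end SpectralResolution

section JetCoeff

variable {ι R : Type*} [Ring R] [Algebra ℂ R] {a : R} {m : ℕ} {lam : ι → ℂ} {P : ι → R}

/-- The coefficients of the jets of `f` in the expansion of `f(a)` along a spectral resolution
`P` of `a`. -/
noncomputable def jetCoeff (a : R) (lam : ι → ℂ) (P : ι → R) (i : ι) (j : ℕ) : R :=
  (j.factorial : ℂ)⁻¹ • ((a - algebraMap ℂ R (lam i)) ^ j * P i)

theorem jetCoeff_affine (a : R) (lam : ι → ℂ) (P : ι → R) (κ τ : ℂ) (i : ι) (j : ℕ) :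
    jetCoeff (algebraMap ℂ R κ + τ • a) (fun i => κ + τ * lam i) P i j =
      τ ^ j • jetCoeff a lam P i j := by
  rw [jetCoeff, jetCoeff, algebraMap_add_smul_sub, smul_pow, smul_mul_assoc, smul_comm]

theorem mul_jetCoeff (a : R) (lam : ι → ℂ) (P : ι → R) (i : ι) (j : ℕ) :
    a * jetCoeff a lam P i j =
      lam i • jetCoeff a lam P i j + (j + 1 : ℂ) • jetCoeff a lam P i (j + 1) := by
  have hsub : (a - algebraMap ℂ R (lam i)) * jetCoeff a lam P i j =
      (j + 1 : ℂ) • jetCoeff a lam P i (j + 1) := by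
    simp only [jetCoeff, mul_smul_comm, smul_smul, pow_succ', mul_assoc, Nat.factorial_succ]
    congr 1
    push_cast
    field_simp
  rw [← hsub, sub_mul, ← Algebra.smul_def, add_sub_cancel]

namespace IsSpectralResolution

variable [Fintype ι] {g : ℂ → ℂ}

theorem jetCoeff_eq_zero (h : IsSpectralResolution a m lam P) (i : ι) :
    jetCoeff a lam P i m = 0 := by
  rw [jetCoeff, h.pow_mul_eq_zero, smul_zero]

theorem mul_jetSum (h : IsSpectralResolution a m lam P) (hg : ∀ i, AnalyticAt ℂ g (lam i)) :
    a * jetSum lam m (jetCoeff a lam P) g =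
      jetSum lam m (jetCoeff a lam P) (fun z => z * g z) := by
  simp only [jetSum, Finset.mul_sum]
  refine Finset.sum_congr rfl fun i _ => ?_
  set T : ℕ → R := fun j => (j * iteratedDeriv (j - 1) g (lam i)) • jetCoeff a lam P i j with hT
  have hshift : ∑ j ∈ Finset.range m, T (j + 1) = ∑ j ∈ Finset.range m, T j := by
    have hsucc := (Finset.sum_range_succ' T m).symm.trans (Finset.sum_range_succ T m)
    simpa [hT, h.jetCoeff_eq_zero] using hsucc
  calc ∑ j ∈ Finset.range m, a * (iteratedDeriv j g (lam i) • jetCoeff a lam P i j)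
      = ∑ j ∈ Finset.range m,
          ((lam i * iteratedDeriv j g (lam i)) • jetCoeff a lam P i j + T (j + 1)) := by
        refine Finset.sum_congr rfl fun j _ => ?_
        simp only [mul_smul_comm, mul_jetCoeff, hT, Nat.add_sub_cancel, smul_add, smul_smul,
          Nat.cast_add_one, mul_comm]
    _ = ∑ j ∈ Finset.range m,
          ((lam i * iteratedDeriv j g (lam i)) • jetCoeff a lam P i j + T j) := by
        rw [Finset.sum_add_distrib, hshift, ← Finset.sum_add_distrib]
    _ = ∑ j ∈ Finset.range m,
          iteratedDeriv j (fun z => z * g z) (lam i) • jetCoeff a lam P i j := by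
        refine Finset.sum_congr rfl fun j _ => ?_
        have hleibniz := iteratedDeriv_sub_const_mul (hg i) 0 j
        simp only [sub_zero] at hleibniz
        rw [hleibniz, add_smul]

theorem aeval_mul_jetSum (h : IsSpectralResolution a m lam P) (p : Polynomial ℂ)
    (hg : ∀ i, AnalyticAt ℂ g (lam i)) :
    Polynomial.aeval a p * jetSum lam m (jetCoeff a lam P) g =
      jetSum lam m (jetCoeff a lam P) (fun z => p.eval z * g z) := by
  induction p using Polynomial.induction_on generalizing g with
  | C b => simp only [Polynomial.aeval_C, Polynomial.eval_C, jetSum_const_mul, Algebra.smul_def]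
  | add p q hp hq =>
    have hmul (r : Polynomial ℂ) (i : ι) : AnalyticAt ℂ (fun z => r.eval z * g z) (lam i) :=
      (r.differentiable.analyticAt _).mul (hg i)
    simp only [map_add, add_mul, hp hg, hq hg, Polynomial.eval_add, jetSum_add (hmul p) (hmul q)]
  | monomial k b hk =>
    rw [pow_succ, ← mul_assoc, map_mul, Polynomial.aeval_X, mul_assoc, h.mul_jetSum hg,
      hk (g := fun z => z * g z) fun i => analyticAt_id.mul (hg i)]
    simp only [Polynomial.eval_mul, Polynomial.eval_X, mul_assoc]

end IsSpectralResolution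

end JetCoeff

theorem isUnit_aeval_of_eval_ne_zero {K R : Type*} [Field K] [IsAlgClosed K] [Ring R]
    [Algebra K R] [FiniteDimensional K R] {a : R} {p : Polynomial K}
    (hp : ∀ l ∈ spectrum K a, p.eval l ≠ 0) : IsUnit (Polynomial.aeval a p) := by
  cases subsingleton_or_nontrivial R with
  | inl _ => exact isUnit_of_subsingleton _
  | inr _ =>
    rw [← spectrum.zero_notMem_iff K, spectrum.map_polynomial_aeval_of_nonempty a p
      (spectrum.nonempty_of_isAlgClosed_of_finiteDimensional K a)]
    rintro ⟨l, hl, hzero⟩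
    exact hp l hl hzero

section MatrixFunction

open Metric

theorem eventually_analyticOnNhd_closedBall {𝕜 E F : Type*} [NontriviallyNormedField 𝕜]
    [NormedAddCommGroup E] [NormedSpace 𝕜 E] [NormedAddCommGroup F] [NormedSpace 𝕜 F]
    [CompleteSpace F] {f : E → F} {x : E} (hf : AnalyticAt 𝕜 f x) :
    ∀ᶠ r in nhdsWithin (0 : ℝ) (Set.Ioi 0), AnalyticOnNhd 𝕜 f (closedBall x r) := by
  obtain ⟨ε, hε, hball⟩ :=
    nhds_basis_closedBall.eventually_iff.mp hf.eventually_analyticAt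
  filter_upwards [Ioo_mem_nhdsGT hε] with r hr y hy
  exact hball (closedBall_subset_closedBall hr.2.le hy)

theorem eventually_disjoint_closedBall {X : Type*} [MetricSpace X] {x y : X} (hxy : x ≠ y) :
    ∀ᶠ r in nhdsWithin (0 : ℝ) (Set.Ioi 0), Disjoint (closedBall x r) (closedBall y r) := by
  filter_upwards [Ioo_mem_nhdsGT (half_pos (dist_pos.mpr hxy))] with r hr
  exact closedBall_disjoint_closedBall (by linarith [hr.2])

variable {n : ℕ} {A : Matrix (Fin n) (Fin n) ℂ} {f : ℂ → ℂ} {Γ : Finset (ℂ × ℝ)}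

theorem exists_enclosesSpectrum (hf : ∀ l ∈ spectrum ℂ A, AnalyticAt ℂ f l) :
    ∃ Γ, EnclosesSpectrum Γ f A := by
  classical
  have hfin := A.finite_spectrum
  have hanalytic : ∀ᶠ r in nhdsWithin (0 : ℝ) (Set.Ioi 0), ∀ l ∈ spectrum ℂ A,
      AnalyticOnNhd ℂ f (closedBall l r) :=
    (Filter.eventually_all_finite hfin).mpr fun l hl =>
      eventually_analyticOnNhd_closedBall (hf l hl)
  have hdisjoint : ∀ᶠ r in nhdsWithin (0 : ℝ) (Set.Ioi 0), ∀ l ∈ spectrum ℂ A,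
      ∀ l' ∈ spectrum ℂ A, l ≠ l' → Disjoint (closedBall l r) (closedBall l' r) :=
    (Filter.eventually_all_finite hfin).mpr fun l _ =>
      (Filter.eventually_all_finite hfin).mpr fun l' _ =>
        Filter.eventually_imp_distrib_left.mpr eventually_disjoint_closedBall
  obtain ⟨r, ⟨hrf, hrd⟩, hr⟩ := ((hanalytic.and hdisjoint).and self_mem_nhdsWithin).exists
  refine ⟨hfin.toFinset.image fun l => (l, r), ?_, ?_, ?_, fun l hl =>
    ⟨(l, r), Finset.mem_image_of_mem _ (hfin.mem_toFinset.mpr hl), mem_ball_self hr⟩⟩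
  all_goals simp only [Finset.forall_mem_image, hfin.mem_toFinset]
  · exact fun _ _ => hr
  · exact fun l hl l' hl' hne => hrd l hl l' hl' fun h => hne (by rw [h])
  · exact hrf

theorem EnclosesSpectrum.notMem_closedBall (hΓ : EnclosesSpectrum Γ f A) {p q : ℂ × ℝ}
    (hp : p ∈ Γ) (hq : q ∈ Γ) (hqp : q ≠ p) {w : ℂ} (hw : w ∈ ball p.1 p.2) :
    w ∉ closedBall q.1 q.2 := fun hwq =>
  Set.disjoint_left.mp (hΓ.disjoint q hq p hp hqp) hwq (ball_subset_closedBall hw)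

theorem EnclosesSpectrum.notMem_sphere (hΓ : EnclosesSpectrum Γ f A) {w : ℂ}
    (hw : w ∈ spectrum ℂ A) {q : ℂ × ℝ} (hq : q ∈ Γ) : w ∉ sphere q.1 q.2 := by
  obtain ⟨p, hp, hwp⟩ := hΓ.encloses w hw
  rcases eq_or_ne q p with rfl | hqp
  · exact fun h => (mem_ball.mp hwp).ne (mem_sphere.mp h)
  · exact fun h => hΓ.notMem_closedBall hp hq hqp hwp (sphere_subset_closedBall h)

theorem EnclosesSpectrum.sum_circleIntegral_inv_sub_pow_smul (hΓ : EnclosesSpectrum Γ f A)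
    {w : ℂ} (hw : w ∈ spectrum ℂ A) (j : ℕ) :
    ∑ p ∈ Γ, (∮ z in C(p.1, p.2), ((z - w) ^ (j + 1))⁻¹ • f z) =
      (2 * Real.pi * Complex.I / j.factorial : ℂ) • iteratedDeriv j f w := by
  obtain ⟨p, hp, hwp⟩ := hΓ.encloses w hw
  rw [Finset.sum_eq_single_of_mem p hp fun q hq hqp =>
    circleIntegral_inv_sub_pow_smul_of_notMem_closedBall (hΓ.radius_pos q hq) (hΓ.analytic q hq)
      (hΓ.notMem_closedBall hp hq hqp hwp) (j + 1)]
  exact circleIntegral_inv_sub_pow_smul_of_mem_ball (hΓ.analytic p hp) hwp j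

namespace IsSpectralResolution

variable {ι : Type*} [Fintype ι] {m : ℕ} {lam : ι → ℂ} {P : ι → Matrix (Fin n) (Fin n) ℂ}

theorem circleIntegral_mul_inv_apply (h : IsSpectralResolution A m lam P) {c : ℂ} {R : ℝ}
    (hR : 0 ≤ R) (hf : ContinuousOn f (sphere c R)) (hlam : ∀ i, lam i ∉ sphere c R)
    (k l : Fin n) :
    (∮ z in C(c, R), f z * (z • (1 : Matrix (Fin n) (Fin n) ℂ) - A)⁻¹ k l) =
      ∑ i, ∑ j ∈ Finset.range m, ((A - algebraMap ℂ _ (lam i)) ^ j * P i) k l *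
        ∮ z in C(c, R), ((z - lam i) ^ (j + 1))⁻¹ • f z := by
  have hint (i : ι) (j : ℕ) : CircleIntegrable (fun z =>
      ((A - algebraMap ℂ _ (lam i)) ^ j * P i) k l * (((z - lam i) ^ (j + 1))⁻¹ • f z)) c R :=
    (circleIntegrable_inv_sub_pow_smul hR hf (hlam i) (j + 1)).const_fun_smul
  have hexpand : Set.EqOn (fun z => f z * (z • (1 : Matrix (Fin n) (Fin n) ℂ) - A)⁻¹ k l)
      (fun z => ∑ i, ∑ j ∈ Finset.range m,
        ((A - algebraMap ℂ _ (lam i)) ^ j * P i) k l * (((z - lam i) ^ (j + 1))⁻¹ • f z))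
      (sphere c R) := fun z hz => by
    have hinv := Matrix.inv_eq_right_inv
      (h.algebraMap_sub_mul_sum fun i => ne_of_mem_of_not_mem hz (hlam i))
    rw [Algebra.algebraMap_eq_smul_one] at hinv
    simp only [hinv, Matrix.sum_apply, Matrix.smul_apply, smul_eq_mul, Finset.mul_sum]
    exact Finset.sum_congr rfl fun i _ => Finset.sum_congr rfl fun j _ => by ring
  rw [circleIntegral.integral_congr hR hexpand, circleIntegral.integral_fun_sum fun i _ =>
    CircleIntegrable.fun_sum _ fun j _ => hint i j]
  simp only [circleIntegral.integral_fun_sum fun j _ => hint _ j,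
    circleIntegral.integral_const_mul]

theorem resolventIntegral_eq_jetSum (h : IsSpectralResolution A m lam P)
    (hΓ : EnclosesSpectrum Γ f A) :
    resolventIntegral Γ f A = jetSum lam m (jetCoeff A lam P) f := by
  ext k l
  have hcircle (p : ℂ × ℝ) (hp : p ∈ Γ) := h.circleIntegral_mul_inv_apply (hΓ.radius_pos p hp).le
    ((hΓ.analytic p hp).continuousOn.mono sphere_subset_closedBall)
    (fun i => hΓ.notMem_sphere (h.mem_spectrum i) hp) k l
  simp only [resolventIntegral, Matrix.of_apply, jetSum, jetCoeff, Matrix.sum_apply,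
    Matrix.smul_apply, smul_eq_mul]
  rw [Finset.sum_congr rfl hcircle, Finset.sum_comm, Finset.mul_sum]
  refine Finset.sum_congr rfl fun i _ => ?_
  rw [Finset.sum_comm, Finset.mul_sum]
  refine Finset.sum_congr rfl fun j _ => ?_
  rw [← Finset.mul_sum, hΓ.sum_circleIntegral_inv_sub_pow_smul (h.mem_spectrum i), smul_eq_mul]
  field_simp [Complex.two_pi_I_ne_zero]

theorem matrixFunction_eq_jetSum (h : IsSpectralResolution A m lam P)
    (hf : ∀ i, AnalyticAt ℂ f (lam i)) :
    matrixFunction f A = jetSum lam m (jetCoeff A lam P) f := by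
  have hexists : ∃ Γ, EnclosesSpectrum Γ f A := exists_enclosesSpectrum fun l hl => by
    obtain ⟨i, rfl⟩ := h.mem_range_of_mem_spectrum hl
    exact hf i
  rw [matrixFunction, dif_pos hexists]
  exact h.resolventIntegral_eq_jetSum hexists.choose_spec

theorem matrixFunction_affine_eq_jetSum (h : IsSpectralResolution A m lam P) {κ τ : ℂ}
    (hf : ∀ i, AnalyticAt ℂ f (κ + τ * lam i)) :
    matrixFunction f (κ • 1 + τ • A) =
      jetSum lam m (jetCoeff A lam P) (fun w => f (κ + τ * w)) := by
  rw [← Algebra.algebraMap_eq_smul_one, (h.affine κ τ).matrixFunction_eq_jetSum hf,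
    jetSum_comp_affine f]
  simp only [jetSum, jetCoeff_affine]

end IsSpectralResolution

end MatrixFunction

section Remainder

variable {n N : ℕ}

/-- The linear functional `X ↦ dᴴ R X b` on matrices, which turns matrix-valued jet sums into
scalar ones. -/
def sandwichLinear (R : Matrix (Fin n) (Fin n) ℂ) (d b : Fin n → ℂ) :
    Matrix (Fin n) (Fin n) ℂ →ₗ[ℂ] ℂ where
  toFun X := sandwich d (R * X) b
  map_add' X Y := by simp only [sandwich, mul_add, Matrix.add_mulVec, dotProduct_add]
  map_smul' a X := by
    simp only [sandwich, mul_smul_comm, Matrix.smul_mulVec, dotProduct_smul, RingHom.id_apply]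

namespace IsSpectralResolution

variable {ι : Type*} [Fintype ι] {m : ℕ} {lam : ι → ℂ} {A : Matrix (Fin n) (Fin n) ℂ}
  {P : ι → Matrix (Fin n) (Fin n) ℂ} {f G : ℂ → ℂ} {u v ω : Polynomial ℂ} {z : Fin N → ℂ}
  {H K : Set ℂ} {d b : Fin n → ℂ}

theorem matrixFunction_sub_matrixFunction_ratioFun (h : IsSpectralResolution A m lam P)
    (hf : ∀ i, AnalyticAt ℂ f (lam i)) (hG : ∀ i, AnalyticAt ℂ G (lam i))
    (hv : ∀ l ∈ spectrum ℂ A, v.eval l ≠ 0)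
    (hfactor : (fun w => v.eval w * f w - u.eval w) = fun w => ω.eval w * G w) :
    matrixFunction f A - matrixFunction (ratioFun u v) A =
      Polynomial.aeval A ω * (Polynomial.aeval A v)⁻¹ * jetSum lam m (jetCoeff A lam P) G := by
  have hva (i : ι) : AnalyticAt ℂ (fun w => v.eval w) (lam i) := v.differentiable.analyticAt _
  have hvlam (i : ι) : v.eval (lam i) ≠ 0 := hv _ (h.mem_spectrum i)
  have hr (i : ι) : AnalyticAt ℂ (ratioFun u v) (lam i) :=
    (u.differentiable.analyticAt _).div (hva i) (hvlam i)
  have hmul : Polynomial.aeval A v * (matrixFunction f A - matrixFunction (ratioFun u v) A) =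
      Polynomial.aeval A ω * jetSum lam m (jetCoeff A lam P) G := by
    rw [h.matrixFunction_eq_jetSum hf, h.matrixFunction_eq_jetSum hr, ← jetSum_sub hf hr,
      h.aeval_mul_jetSum v fun i => (hf i).fun_sub (hr i), h.aeval_mul_jetSum ω hG, ← hfactor]
    refine jetSum_congr fun i => ?_
    filter_upwards [(hva i).continuousAt.eventually_ne (hvlam i)] with w hw
    rw [ratioFun]
    field_simp
  have hunit := isUnit_aeval_of_eval_ne_zero hv
  have hcomm : Commute (Polynomial.aeval A ω) (Polynomial.aeval A v)⁻¹ := by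
    rw [← hunit.unit_spec, ← Matrix.coe_units_inv]
    exact ((Commute.all ω v).map (Polynomial.aeval A)).units_inv_right
  rw [hcomm.eq, mul_assoc, ← hmul,
    Matrix.nonsing_inv_mul_cancel_left _ _ ((Matrix.isUnit_iff_isUnit_det _).mp hunit)]

theorem sandwich_remainderMatrix (h : IsSpectralResolution A m lam P) {t : ℝ} {μ : ℂ}
    (hf : ∀ i, AnalyticAt ℂ f ((1 - t) * μ + t * lam i)) :
    sandwich d (remainderMatrix A z f v t μ) b =
      (N.factorial : ℂ)⁻¹ * jetSum lam m
        (fun i j => sandwichLinear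
          (Polynomial.aeval A (nodePolynomial z) * (Polynomial.aeval A v)⁻¹) d b
          (jetCoeff A lam P i j))
        (fun w => iteratedDeriv N (fun y => v.eval y * f y) ((1 - t) * μ + t * w)) := by
  have hderiv (i : ι) : AnalyticAt ℂ (iteratedDeriv N fun y => v.eval y * f y)
      ((1 - t) * μ + t * lam i) :=
    analyticAt_iteratedDeriv ((v.differentiable.analyticAt _).mul (hf i)) N
  rw [← map_jetSum, ← h.matrixFunction_affine_eq_jetSum hderiv, ← smul_eq_mul, ← map_smul]
  rfl

theorem exists_isGreatest_norm_sandwich_remainderMatrix (h : IsSpectralResolution A m lam P)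
    (hf : AnalyticOnNhd ℂ f H) (hH : Convex ℝ H) (hAH : spectrum ℂ A ⊆ H) (hK : IsCompact K)
    (hKne : K.Nonempty) (hKH : K ⊆ H) :
    ∃ M, IsGreatest ((fun p : ℝ × ℂ => ‖sandwich d (remainderMatrix A z f v p.1 p.2) b‖) ''
      (Set.Icc (0 : ℝ) 1 ×ˢ K)) M := by
  have hmem (t : ℝ) (ht : t ∈ Set.Icc (0 : ℝ) 1) (μ : ℂ) (hμ : μ ∈ K) (i : ι) :
      (1 - t) * μ + t * lam i ∈ H :=
    one_sub_mul_add_mul_mem hH (hKH hμ) (hAH (h.mem_spectrum i)) ht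
  have hderiv : AnalyticOnNhd ℂ (iteratedDeriv N fun y => v.eval y * f y) H := fun w hw =>
    analyticAt_iteratedDeriv (analyticOnNhd_eval_mul hf v w hw) N
  refine ((isCompact_Icc.prod hK).image_of_continuousOn ?_).exists_isGreatest
    (((Set.nonempty_Icc.mpr zero_le_one).prod hKne).image _)
  exact (continuousOn_const.mul (continuousOn_jetSum_segment hderiv hmem)).norm.congr
    fun p hp => congrArg norm
      (h.sandwich_remainderMatrix fun i => hf _ (hmem p.1 hp.1 p.2 hp.2 i))

theorem norm_sandwich_matrixFunction_sub_le (h : IsSpectralResolution A m lam P) {U : Set ℂ}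
    (hU : IsOpen U) (hf : AnalyticOnNhd ℂ f U) (hH : Convex ℝ H) (hHU : H ⊆ U)
    (hAH : spectrum ℂ A ⊆ H) (hK : Convex ℝ K) (hKH : K ⊆ H)
    (hzK : ∀ k, z k ∈ K) (hu : u.natDegree < N) (hvz : ∀ k, v.eval (z k) ≠ 0)
    (hvA : ∀ l ∈ spectrum ℂ A, v.eval l ≠ 0) (hr : Interpolates (ratioFun u v) f z) {M : ℝ}
    (hM : ∀ t ∈ Set.Icc (0 : ℝ) 1, ∀ μ ∈ K,
      ‖sandwich d (remainderMatrix A z f v t μ) b‖ ≤ M) :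
    ‖sandwich d (matrixFunction f A - matrixFunction (ratioFun u v) A) b‖ ≤ M := by
  have hlamH (i : ι) : lam i ∈ H := hAH (h.mem_spectrum i)
  have hzU (k : Fin N) : z k ∈ U := hHU (hKH (hzK k))
  have hKne : K.Nonempty := ⟨_, hzK ⟨0, Nat.zero_lt_of_lt hu⟩⟩
  have hvf := analyticOnNhd_eval_mul hf v
  obtain ⟨G, hG, hfactor⟩ := exists_analyticOnNhd_eq_nodePolynomial_mul hU hzU
    (φ := fun w => v.eval w * f w - u.eval w)
    (hvf.sub (u.differentiable.differentiableOn.analyticOnNhd hU)) fun k =>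
      hr.nodeMultiplicity_le_analyticOrderAt k (hf _ (hzU k)) (hvz k)
  rw [h.matrixFunction_sub_matrixFunction_ratioFun (fun i => hf _ (hHU (hlamH i)))
    (fun i => hG _ (hHU (hlamH i))) hvA hfactor]
  change ‖sandwichLinear _ d b _‖ ≤ M
  rw [map_jetSum]
  have hfact : (0 : ℝ) < N.factorial := Nat.cast_pos.mpr N.factorial_pos
  refine (norm_jetSum_le_of_nodePolynomial_mul hH hlamH hK hKne hKH hzK (hG.mono hHU)
    (M := N.factorial * M) fun t ht μ hμ => ?_).trans_eq (mul_div_cancel_left₀ M hfact.ne')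
  have hmem (i : ι) : (1 - t) * μ + t * lam i ∈ U :=
    hHU (one_sub_mul_add_mul_mem hH (hKH hμ) (hlamH i) ht)
  have hle := hM t ht μ hμ
  rw [h.sandwich_remainderMatrix fun i => hf _ (hmem i), norm_mul, norm_inv,
    Complex.norm_natCast, inv_mul_le_iff₀ hfact] at hle
  rwa [← hfactor, jetSum_iteratedDeriv_sub_polynomial_eval (fun i => hvf _ (hmem i)) hu]

end IsSpectralResolution

end Remainder

theorem corollaryc {n N : ℕ} (hN : 0 < N)
    (A : Matrix (Fin n) (Fin n) ℂ) (z : Fin N → ℂ)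
    (U : Set ℂ) (hU : IsOpen U)
    (hsub : convexHull ℝ (spectrum ℂ A ∪ Set.range z) ⊆ U)
    (f : ℂ → ℂ) (hf : AnalyticOnNhd ℂ f U)
    (u v : Polynomial ℂ) (hu : u.natDegree ≤ N - 1)
    (hvz : ∀ k : Fin N, v.eval (z k) ≠ 0)
    (hvA : ∀ l ∈ spectrum ℂ A, v.eval l ≠ 0)
    (hr : Interpolates (ratioFun u v) f z)
    (b d : Fin n → ℂ) :
    IsUnit (Polynomial.aeval A v) ∧
    ∃ M : ℝ,
      IsGreatest
        ((fun p : ℝ × ℂ => ‖sandwich d (remainderMatrix A z f v p.1 p.2) b‖) ''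
          (Set.Icc (0 : ℝ) 1 ×ˢ convexHull ℝ (Set.range z))) M ∧
      ‖sandwich d (matrixFunction f A - matrixFunction (ratioFun u v) A) b‖ ≤ M := by
  refine ⟨isUnit_aeval_of_eval_ne_zero hvA, ?_⟩
  obtain ⟨P, hP⟩ := exists_isSpectralResolution_matrix A
  set H := convexHull ℝ (spectrum ℂ A ∪ Set.range z)
  set K := convexHull ℝ (Set.range z)
  have hAH : spectrum ℂ A ⊆ H := Set.subset_union_left.trans (subset_convexHull ℝ _)
  have hKH : K ⊆ H := convexHull_mono Set.subset_union_right
  have hzK (k : Fin N) : z k ∈ K := subset_convexHull ℝ _ (Set.mem_range_self k)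
  obtain ⟨M, hM⟩ := hP.exists_isGreatest_norm_sandwich_remainderMatrix (z := z) (v := v) (d := d)
    (b := b) (hf.mono hsub) (convex_convexHull ℝ _) hAH
    ((Set.finite_range z).isCompact_convexHull ℝ) ⟨z ⟨0, hN⟩, hzK _⟩ hKH
  exact ⟨M, hM, hP.norm_sandwich_matrixFunction_sub_le hU hf (convex_convexHull ℝ _) hsub hAH
    (convex_convexHull ℝ _) hKH hzK (by lia) hvz hvA hr
    fun t ht μ hμ => hM.2 ⟨(t, μ), ⟨ht, hμ⟩, rfl⟩⟩
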